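/- Let $\Omega\subset\mathbb{R}^3$ be a bounded open set (for instance a bounded convex domain with polyhedral boundary). Let $V:=H^1_0(\Omega)$, the closure of $C_c^\infty(\Omega)$ in $H^1(\Omega)$, and let $\Psi:=H^2(\Omega)\cap H^1_0(\Omega)$; all functions are real-valued. For $u,\psi\in\Psi$ and $\sigma,v\in V$ put $$a^{\Delta}(u,\psi):=\int_\Omega\nabla^2u:\nabla^2\psi\,dx,\qquad a^{\nabla}(\sigma,v):=\int_\Omega\nabla\sigma\cdot\nabla v\,dx,\qquad a^{0}(\sigma,\psi):=\int_\Omega\sigma\psi\,dx .$$ Let $f\in L^2(\Omega)$ and put $F(v):=-\int_\Omega fv\,dx$ for $v\in V$. Then: 1. There is exactly one pair $(\sigma,u)\in V\times\Psi$ such that $$a^{\Delta}(u,\psi)+a^{\nabla}(\sigma,v)+a^{0}(\sigma,\psi)=F(v)\qquad\text{for all }v\in V\text{ and all }\psi\in\Psi.\tag{1}$$ 2. The weak Poisson problem "find $\sigma\in V$ with $a^\nabla(\sigma,v)=F(v)$ for all $v\in V$" has exactly one solution; and for every $\sigma\in V$ the weak fourth-order problem "find $u\in\Psi$ with $a^\Delta(u,\psi)=-a^0(\sigma,\psi)$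 for all $\psi\in\Psi$" has exactly one solution. 3. A pair $(\sigma,u)\in V\times\Psi$ satisfies (1) if and only if $\sigma$ solves the weak Poisson problem and $u$ solves the weak fourth-order problem with this $\sigma$. -/

import Mathlib

open MeasureTheory TopologicalSpace
open scoped Distributions

noncomputable section

namespace SixthOrder

/-- Euclidean three-space. -/
abbrev E3 : Type := EuclideanSpace ℝ (Fin 3)

/-- `L²(Ω)`: classes of real square-integrable functions on the open set `Ω ⊆ ℝ³`,
for Lebesgue measure. -/
abbrev L2 (Ω : Opens E3) : Type := Lp ℝ 2 (volume.restrict (Ω : Set E3))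

/-- The classical partial derivative `∂φ/∂xᵢ`. -/
def partialDeriv (i : Fin 3) (φ : E3 → ℝ) (x : E3) : ℝ :=
  fderiv ℝ φ x (EuclideanSpace.single i 1)

/-- `g` is the weak partial derivative `∂u/∂xᵢ` on `Ω`:
`∫_Ω u ∂ᵢφ = - ∫_Ω g φ` for all `φ ∈ C_c^∞(Ω)`. -/
def HasWeakDeriv {Ω : Opens E3} (i : Fin 3) (u g : L2 Ω) : Prop :=
  ∀ φ : 𝓓(Ω, ℝ),
    ∫ x in (Ω : Set E3), u x * partialDeriv i φ x = - ∫ x in (Ω : Set E3), g x * φ x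

/-- Weak derivatives are unique, so that `weakDeriv` below does not depend on a choice. -/
theorem HasWeakDeriv.unique {Ω : Opens E3} {i : Fin 3} {u g h : L2 Ω}
    (hg : HasWeakDeriv i u g) (hh : HasWeakDeriv i u h) : g = h := by
  have loc : ∀ w : L2 Ω, LocallyIntegrableOn w (Ω : Set E3) volume := by
    intro w
    have h1 : LocallyIntegrable w (volume.restrict (Ω : Set E3)) :=
      (Lp.memLp w).locallyIntegrable (by norm_num)
    exact locallyIntegrableOn_of_locallyIntegrable_restrict h1
  have int : ∀ (w : L2 Ω) (φ : 𝓓(Ω, ℝ)),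
      Integrable (fun x => w x * φ x) (volume.restrict (Ω : Set E3)) := by
    intro w φ
    have hφ : MemLp φ 2 (volume.restrict (Ω : Set E3)) :=
      φ.continuous.memLp_of_hasCompactSupport φ.hasCompactSupport
    exact (Lp.memLp w).integrable_mul hφ
  have key := Ω.isOpen.ae_eq_zero_of_integral_contDiff_smul_eq_zero (μ := volume)
    ((loc g).sub (loc h)) (by
      intro φ h1 h2 h3
      have e := (hg ⟨φ, h1, h2, h3⟩).symm.trans (hh ⟨φ, h1, h2, h3⟩)
      have e1 : ∫ x in (Ω : Set E3), g x * φ x = ∫ x in (Ω : Set E3), h x * φ x :=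
        neg_injective e
      have e2 : ∫ x in (Ω : Set E3), (g x * φ x - h x * φ x) = 0 := by
        exact (integral_sub (int g ⟨φ, h1, h2, h3⟩) (int h ⟨φ, h1, h2, h3⟩)).trans
          (sub_eq_zero.2 e1)
      rw [← setIntegral_eq_integral_of_forall_compl_eq_zero (s := (Ω : Set E3))]
      · rw [← e2]
        congr 1
        ext x
        simp only [Pi.sub_apply, smul_eq_mul]
        ring
      · intro x hx
        rw [image_eq_zero_of_notMem_tsupport fun hx' => hx (h3 hx'), zero_smul])
  refine Lp.ext ?_
  rw [Filter.EventuallyEq, ae_restrict_iff' Ω.isOpen.measurableSet]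
  filter_upwards [key] with x hx hxΩ
  exact sub_eq_zero.1 (hx hxΩ)

open Classical in
/-- The weak partial derivative `∂ᵢu ∈ L²(Ω)` (with the value `0` if there is none). -/
def weakDeriv {Ω : Opens E3} (i : Fin 3) (u : L2 Ω) : L2 Ω :=
  if h : ∃ g : L2 Ω, HasWeakDeriv i u g then h.choose else 0

theorem HasWeakDeriv.weakDeriv_eq {Ω : Opens E3} {i : Fin 3} {u g : L2 Ω}
    (hg : HasWeakDeriv i u g) : weakDeriv i u = g := by
  have h : ∃ g : L2 Ω, HasWeakDeriv i u g := ⟨g, hg⟩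
  rw [weakDeriv, dif_pos h]
  exact h.choose_spec.unique hg

/-- The Sobolev space `H¹(Ω)`. -/
def H1 (Ω : Opens E3) : Set (L2 Ω) :=
  {u | ∀ i : Fin 3, ∃ g : L2 Ω, HasWeakDeriv i u g}

/-- The Sobolev space `H²(Ω)`. -/
def H2 (Ω : Opens E3) : Set (L2 Ω) :=
  {u | u ∈ H1 Ω ∧ ∀ i : Fin 3, weakDeriv i u ∈ H1 Ω}

/-- The norm of `H¹(Ω)`. -/
def h1Norm {Ω : Opens E3} (u : L2 Ω) : ℝ :=
  Real.sqrt (‖u‖ ^ 2 + ∑ i : Fin 3, ‖weakDeriv i u‖ ^ 2)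

/-- The class in `L²(Ω)` of a test function `φ ∈ C_c^∞(Ω)`. -/
def testL2 {Ω : Opens E3} (φ : 𝓓(Ω, ℝ)) : L2 Ω :=
  MemLp.toLp φ (φ.continuous.memLp_of_hasCompactSupport φ.hasCompactSupport)

/-- `V = H¹₀(Ω)`: the closure of `C_c^∞(Ω)` in `H¹(Ω)`. -/
def H10 (Ω : Opens E3) : Set (L2 Ω) :=
  {u | u ∈ H1 Ω ∧ ∀ ε > 0, ∃ φ : 𝓓(Ω, ℝ), h1Norm (u - testL2 φ) < ε}

/-- `Ψ = H²(Ω) ∩ H¹₀(Ω)`. -/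
def Psi (Ω : Opens E3) : Set (L2 Ω) := H2 Ω ∩ H10 Ω

/-- `a^Δ(u, ψ) = ∫_Ω ∇²u : ∇²ψ`. -/
def aDelta {Ω : Opens E3} (u ψ : L2 Ω) : ℝ :=
  ∫ x in (Ω : Set E3), ∑ i : Fin 3, ∑ j : Fin 3,
    weakDeriv i (weakDeriv j u) x * weakDeriv i (weakDeriv j ψ) x

/-- `a^∇(σ, v) = ∫_Ω ∇σ · ∇v`. -/
def aNabla {Ω : Opens E3} (σ v : L2 Ω) : ℝ :=
  ∫ x in (Ω : Set E3), ∑ i : Fin 3, weakDeriv i σ x * weakDeriv i v x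

/-- `a⁰(σ, ψ) = ∫_Ω σ ψ`. -/
def aZero {Ω : Opens E3} (σ ψ : L2 Ω) : ℝ :=
  ∫ x in (Ω : Set E3), σ x * ψ x

/-- `F(v) = - ∫_Ω f v`. -/
def load {Ω : Opens E3} (f v : L2 Ω) : ℝ :=
  - ∫ x in (Ω : Set E3), f x * v x

/-- `(σ, u) ∈ V × Ψ` solves the mixed weak formulation. -/
def IsMixedSolution {Ω : Opens E3} (f σ u : L2 Ω) : Prop :=
  σ ∈ H10 Ω ∧ u ∈ Psi Ω ∧
    ∀ v ∈ H10 Ω, ∀ ψ ∈ Psi Ω, aDelta u ψ + aNabla σ v + aZero σ ψ = load f v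

/-- `σ ∈ V` solves the weak Poisson problem (`Δσ = f` in `Ω`, `σ = 0` on `∂Ω`). -/
def IsPoissonSolution {Ω : Opens E3} (f σ : L2 Ω) : Prop :=
  σ ∈ H10 Ω ∧ ∀ v ∈ H10 Ω, aNabla σ v = load f v

/-- `u ∈ Ψ` solves the weak fourth-order problem
(`Δ²u + σ = 0` in `Ω`, `u = Δu = 0` on `∂Ω`). -/
def IsFourthOrderSolution {Ω : Opens E3} (σ u : L2 Ω) : Prop :=
  u ∈ Psi Ω ∧ ∀ ψ ∈ Psi Ω, aDelta u ψ = - aZero σ ψ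

end SixthOrder

end

/-! Since `v` and `ψ` vary independently, testing with `ψ = 0` or `v = 0` decouples the mixed
problem: a Poisson problem for `σ`, then a fourth-order problem for `u` with `σ` as data. Both have
the form `⟪T u, T ψ⟫ = ⟪f, ψ⟫`, where `T` (weak gradient or weak Hessian) is a closed operator on
`L²(Ω)` with `‖u‖ ≤ C ‖T u‖`. Riesz representation on the range of `T` then gives existence and
uniqueness (`existsUnique_mem_graph_inner_eq`).

For the gradient on `H¹₀` the bound is Poincaré's inequality, proved for test functions and passed
to the closure. For the Hessian on `H² ∩ H¹₀`, integrating by parts against `u` bounds the gradient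
by the Hessian (`norm_le_norm_weakHess`); this also makes the Hessian closed (`isClosed_hessGraph`).
All integrations by parts are against functions in `H¹₀`, so the boundary of `Ω` needs no
regularity. -/

open MeasureTheory TopologicalSpace
open scoped Distributions

noncomputable section

namespace SixthOrder
-- Riesz representation for closed operators bounded from below
section Abstract

variable {H K : Type*} [NormedAddCommGroup H] [InnerProductSpace ℝ H] [CompleteSpace H]
  [NormedAddCommGroup K] [InnerProductSpace ℝ K] [CompleteSpace K]

/-- Riesz representation for the form `⟪T u, T v⟫`, where `T` is a closed operator with graph `G`
that is bounded from below. -/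
theorem existsUnique_mem_graph_inner_eq (G : Submodule ℝ (H × K)) (hG : IsClosed (G : Set (H × K)))
    (C : ℝ) (hC : ∀ p ∈ G, ‖p.1‖ ≤ C * ‖p.2‖) (f : H) :
    ∃! p : H × K, p ∈ G ∧ ∀ q ∈ G, inner ℝ p.2 q.2 = inner ℝ f q.1 := by
  let P : G →L[ℝ] K := (ContinuousLinearMap.snd ℝ H K).comp G.subtypeL
  have hPa : ∀ p : G, P p = (p : H × K).2 := fun _ => rfl
  -- The product carries the sup norm: the first component costs `C`, the second `1`. This lower
  -- bound makes the range of `P` closed, hence complete.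
  have hbd : ∀ p : G, ‖p‖ ≤ (Real.toNNReal (max C 1) : ℝ) * ‖P p‖ := by
    intro p
    rw [Real.coe_toNNReal _ (le_trans zero_le_one (le_max_right _ _)), hPa]
    change max ‖(p : H × K).1‖ ‖(p : H × K).2‖ ≤ _
    refine max_le ((hC p p.2).trans ?_) ?_
    · exact mul_le_mul_of_nonneg_right (le_max_left _ _) (norm_nonneg _)
    · exact le_mul_of_one_le_left (norm_nonneg _) (le_max_right _ _)
  have hanti : AntilipschitzWith (Real.toNNReal (max C 1)) P := P.antilipschitz_of_bound hbd
  have : CompleteSpace G := hG.completeSpace_coe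
  have hcl : IsClosed (Set.range P) := hanti.isClosed_range P.uniformContinuous
  let R : Submodule ℝ K := LinearMap.range (P : G →ₗ[ℝ] K)
  have hRc : IsClosed (R : Set K) := by
    rw [LinearMap.coe_range]; exact hcl
  have : CompleteSpace R := hRc.completeSpace_coe
  let e : G ≃ₗ[ℝ] R := LinearEquiv.ofInjective (P : G →ₗ[ℝ] K) hanti.injective
  have he : ∀ p : G, ((e p : R) : K) = (p : H × K).2 := fun _ => rfl
  -- The functional `T u ↦ ⟪f, u⟫`, well defined because `T` is injective and bounded by `‖f‖ * C`.
  let fn : R →ₗ[ℝ] ℝ :=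
    ((innerₛₗ ℝ f).comp ((LinearMap.fst ℝ H K).comp G.subtype)).comp e.symm.toLinearMap
  have hfn : ∀ r, fn r = inner ℝ f ((e.symm r : G) : H × K).1 := fun _ => rfl
  let l : R →L[ℝ] ℝ := fn.mkContinuous (‖f‖ * C) (by
    intro r
    rw [hfn, mul_assoc]
    refine (norm_inner_le_norm _ _).trans (mul_le_mul_of_nonneg_left ?_ (norm_nonneg _))
    refine (hC _ (e.symm r).2).trans_eq ?_
    rw [← he, e.apply_symm_apply]
    rfl)
  let r : R := (InnerProductSpace.toDual ℝ R).symm l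
  have hr : ∀ s : R, inner ℝ r s = inner ℝ f ((e.symm s : G) : H × K).1 := by
    intro s
    rw [InnerProductSpace.toDual_symm_apply]
    rfl
  have hsol : ∀ q (hq : q ∈ G), inner ℝ ((e.symm r : G) : H × K).2 q.2 = inner ℝ f q.1 := by
    intro q hq
    have h := hr (e ⟨q, hq⟩)
    rw [e.symm_apply_apply, Submodule.coe_inner, he] at h
    rw [← he, e.apply_symm_apply]
    exact h
  refine ⟨(e.symm r : G), ⟨(e.symm r).2, hsol⟩, ?_⟩
  rintro p ⟨hp, hpq⟩
  have hd := G.sub_mem hp (e.symm r).2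
  -- Uniqueness: the difference of two solutions is tested against itself.
  have h0 : inner ℝ (p - (e.symm r : G)).2 (p - (e.symm r : G)).2 = (0 : ℝ) := by
    nth_rewrite 1 [Prod.snd_sub]
    rw [inner_sub_left, hpq _ hd, hsol _ hd, sub_self]
  have h2 : (p - (e.symm r : G)).2 = 0 := inner_self_eq_zero.1 h0
  have h1 : (p - (e.symm r : G)).1 = 0 := by
    have := hC _ hd
    rw [h2, norm_zero, mul_zero] at this
    exact norm_le_zero_iff.1 this
  exact sub_eq_zero.1 (Prod.ext h1 h2)

end Abstract

/-! ### Weak derivatives as `L²` pairings, and Poincaré's inequality for test functions -/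

variable {Ω : Opens E3}

theorem inner_eq_integral (u v : L2 Ω) :
    inner ℝ u v = ∫ x in (Ω : Set E3), u x * v x := by
  rw [L2.inner_def]
  refine integral_congr_ae (Filter.Eventually.of_forall fun x => ?_)
  simp [mul_comm]

theorem integrable_mul (u v : L2 Ω) :
    Integrable (fun x => u x * v x) (volume.restrict (Ω : Set E3)) :=
  (Lp.memLp u).integrable_mul (Lp.memLp v)

theorem coeFn_testL2 (φ : 𝓓(Ω, ℝ)) : testL2 φ =ᵐ[volume.restrict (Ω : Set E3)] φ :=
  MemLp.coeFn_toLp _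

theorem inner_testL2 (u : L2 Ω) (φ : 𝓓(Ω, ℝ)) :
    inner ℝ u (testL2 φ) = ∫ x in (Ω : Set E3), u x * φ x := by
  rw [inner_eq_integral]
  refine integral_congr_ae ?_
  filter_upwards [coeFn_testL2 φ] with x hx
  rw [hx]

theorem testL2_add (φ ψ : 𝓓(Ω, ℝ)) : testL2 (φ + ψ) = testL2 φ + testL2 ψ := rfl

theorem contDiff_partialDeriv (i : Fin 3) {φ : E3 → ℝ} (hφ : ContDiff ℝ (⊤ : ℕ∞) φ) :
    ContDiff ℝ (⊤ : ℕ∞) (partialDeriv i φ) :=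
  (hφ.fderiv_right (m := (⊤ : ℕ∞)) (by norm_cast)).clm_apply contDiff_const

theorem tsupport_partialDeriv_subset (i : Fin 3) (φ : E3 → ℝ) :
    tsupport (partialDeriv i φ) ⊆ tsupport φ :=
  tsupport_fderiv_apply_subset ℝ _

/-- The partial derivative of a test function, as a test function. -/
def testPartial (i : Fin 3) (φ : 𝓓(Ω, ℝ)) : 𝓓(Ω, ℝ) where
  toFun := partialDeriv i φ
  contDiff' := contDiff_partialDeriv i φ.contDiff
  hasCompactSupport' := φ.hasCompactSupport.mono' <|
    (subset_tsupport _).trans (tsupport_partialDeriv_subset i φ)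
  tsupport_subset' := (tsupport_partialDeriv_subset i φ).trans φ.tsupport_subset

/-- A test function multiplied by the coordinate `xᵢ`. -/
def testCoordMul (i : Fin 3) (φ : 𝓓(Ω, ℝ)) : 𝓓(Ω, ℝ) where
  toFun := fun x => x i * φ x
  contDiff' := (EuclideanSpace.proj (𝕜 := ℝ) i).contDiff.mul φ.contDiff
  hasCompactSupport' := φ.hasCompactSupport.mul_left
  tsupport_subset' := (closure_mono (Function.support_mul_subset_right _ _)).trans φ.tsupport_subset

theorem testCoordMul_apply (i : Fin 3) (φ : 𝓓(Ω, ℝ)) (x : E3) :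
    testCoordMul i φ x = x i * φ x := rfl

/-- This product rule drives Poincaré's inequality: it recovers `φ` from derivatives. -/
theorem testPartial_testCoordMul (i : Fin 3) (φ : 𝓓(Ω, ℝ)) :
    testPartial i (testCoordMul i φ) = φ + testCoordMul i (testPartial i φ) := by
  ext x
  have h1 : HasFDerivAt (fun y : E3 => y i) (EuclideanSpace.proj (𝕜 := ℝ) i) x :=
    (EuclideanSpace.proj (𝕜 := ℝ) i).hasFDerivAt
  have h2 : HasFDerivAt φ (fderiv ℝ φ x) x :=
    (φ.contDiff.differentiable (by simp)).differentiableAt.hasFDerivAt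
  have h3 : fderiv ℝ (testCoordMul i φ) x = _ := (h1.mul h2).fderiv
  change fderiv ℝ (testCoordMul i φ) x (EuclideanSpace.single i 1) =
    φ x + x i * fderiv ℝ φ x (EuclideanSpace.single i 1)
  rw [h3]
  simp [add_comm]

theorem hasWeakDeriv_iff_inner {i : Fin 3} {u g : L2 Ω} :
    HasWeakDeriv i u g ↔
      ∀ φ : 𝓓(Ω, ℝ), inner ℝ u (testL2 (testPartial i φ)) = - inner ℝ g (testL2 φ) := by
  simp only [inner_testL2]
  rfl

theorem HasWeakDeriv.add {i : Fin 3} {u v g h : L2 Ω} (hu : HasWeakDeriv i u g)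
    (hv : HasWeakDeriv i v h) : HasWeakDeriv i (u + v) (g + h) := by
  rw [hasWeakDeriv_iff_inner] at *
  intro φ
  rw [inner_add_left, inner_add_left, hu, hv, neg_add]

theorem HasWeakDeriv.smul {i : Fin 3} {u g : L2 Ω} (c : ℝ) (hu : HasWeakDeriv i u g) :
    HasWeakDeriv i (c • u) (c • g) := by
  rw [hasWeakDeriv_iff_inner] at *
  intro φ
  rw [real_inner_smul_left, real_inner_smul_left, hu, mul_neg]

theorem HasWeakDeriv.sub {i : Fin 3} {u v g h : L2 Ω} (hu : HasWeakDeriv i u g)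
    (hv : HasWeakDeriv i v h) : HasWeakDeriv i (u - v) (g - h) := by
  rw [hasWeakDeriv_iff_inner] at *
  intro φ
  rw [inner_sub_left, inner_sub_left, hu, hv]
  ring

theorem hasWeakDeriv_zero (i : Fin 3) : HasWeakDeriv i (0 : L2 Ω) 0 := by
  rw [hasWeakDeriv_iff_inner]
  simp

/-- Each test function imposes one equation continuous in both `L²` arguments. -/
theorem isClosed_hasWeakDeriv (i : Fin 3) : IsClosed {p : L2 Ω × L2 Ω | HasWeakDeriv i p.1 p.2} := by
  simp only [hasWeakDeriv_iff_inner, Set.ofPred_forall]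
  exact isClosed_iInter fun φ => isClosed_eq (by fun_prop) (by fun_prop)

theorem weakDeriv_spec {u : L2 Ω} (hu : u ∈ H1 Ω) (i : Fin 3) :
    HasWeakDeriv i u (weakDeriv i u) := by
  obtain ⟨g, hg⟩ := hu i
  rwa [hg.weakDeriv_eq]

theorem setIntegral_testFunction_mul (φ : 𝓓(Ω, ℝ)) (g : E3 → ℝ) :
    ∫ x in (Ω : Set E3), φ x * g x = ∫ x, φ x * g x := by
  refine setIntegral_eq_integral_of_forall_compl_eq_zero fun x hx => ?_
  rw [image_eq_zero_of_notMem_tsupport fun h => hx (φ.tsupport_subset h), zero_mul]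

theorem hasWeakDeriv_testL2 (i : Fin 3) (φ : 𝓓(Ω, ℝ)) :
    HasWeakDeriv i (testL2 φ) (testL2 (testPartial i φ)) := by
  rw [hasWeakDeriv_iff_inner]
  intro ψ
  have int : ∀ χ ξ : 𝓓(Ω, ℝ), Integrable (fun x => χ x * ξ x) := fun χ ξ =>
    (χ.continuous.mul ξ.continuous).integrable_of_hasCompactSupport χ.hasCompactSupport.mul_right
  have key : ∀ χ ξ : 𝓓(Ω, ℝ), inner ℝ (testL2 χ) (testL2 ξ) = ∫ x, χ x * ξ x := by
    intro χ ξ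
    rw [inner_testL2, ← setIntegral_testFunction_mul]
    refine integral_congr_ae ?_
    filter_upwards [coeFn_testL2 χ] with x hx
    rw [hx]
  rw [key, key]
  exact integral_mul_fderiv_eq_neg_fderiv_mul_of_integrable (int (testPartial i φ) ψ)
    (int φ (testPartial i ψ)) (int φ ψ)
    (fun x _ => (φ.contDiff.differentiable (by simp)).differentiableAt)
    (fun x _ => (ψ.contDiff.differentiable (by simp)).differentiableAt)

theorem norm_testL2_coordMul_le {R : ℝ} (hR : ∀ x ∈ Ω, ‖x‖ ≤ R) (i : Fin 3) (φ : 𝓓(Ω, ℝ)) :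
    ‖testL2 (testCoordMul i φ)‖ ≤ R * ‖testL2 φ‖ := by
  refine Lp.norm_le_mul_norm_of_ae_le_mul ?_
  filter_upwards [coeFn_testL2 φ, coeFn_testL2 (testCoordMul i φ),
    ae_restrict_mem Ω.isOpen.measurableSet] with x h1 h2 hx
  rw [h1, h2, testCoordMul_apply, norm_mul]
  exact mul_le_mul_of_nonneg_right ((PiLp.norm_apply_le x i).trans (hR x hx)) (norm_nonneg _)

/-- The Poincaré inequality for test functions. -/
theorem norm_testL2_le {R : ℝ} (hR0 : 0 ≤ R) (hR : ∀ x ∈ Ω, ‖x‖ ≤ R) (i : Fin 3) (φ : 𝓓(Ω, ℝ)) :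
    ‖testL2 φ‖ ≤ 2 * R * ‖testL2 (testPartial i φ)‖ := by
  -- Pairing with `xᵢφ` gives `‖φ‖² = -2 ⟪∂ᵢφ, xᵢφ⟫`; the constant `2 * R` comes from `|xᵢ| ≤ R` on
  -- `Ω`.
  have h1 := hasWeakDeriv_iff_inner.1 (hasWeakDeriv_testL2 i φ) (testCoordMul i φ)
  have h2 : inner ℝ (testL2 φ) (testL2 (testCoordMul i (testPartial i φ))) =
      inner ℝ (testL2 (testPartial i φ)) (testL2 (testCoordMul i φ)) := by
    rw [inner_testL2, inner_testL2]
    refine integral_congr_ae ?_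
    filter_upwards [coeFn_testL2 φ, coeFn_testL2 (testPartial i φ)] with x hx hx'
    rw [hx, hx', testCoordMul_apply, testCoordMul_apply]
    ring
  rw [testPartial_testCoordMul, testL2_add, inner_add_right, h2, real_inner_self_eq_norm_sq] at h1
  have h3 := (abs_le.1 (abs_real_inner_le_norm (testL2 (testPartial i φ))
    (testL2 (testCoordMul i φ)))).1
  have h4 := mul_le_mul_of_nonneg_left (norm_testL2_coordMul_le hR i φ)
    (norm_nonneg (testL2 (testPartial i φ)))
  rcases (norm_nonneg (testL2 φ)).eq_or_lt with h0 | h0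
  · rw [← h0]
    positivity
  · refine le_of_mul_le_mul_right ?_ h0
    nlinarith

/-! ### The gradient on `H¹₀(Ω)` as a closed operator -/

/-- Vector fields on `Ω` with components in `L²(Ω)`. -/
abbrev L2Vec (Ω : Opens E3) : Type := PiLp 2 fun _ : Fin 3 => L2 Ω

/-- Matrix fields on `Ω` with entries in `L²(Ω)`. -/
abbrev L2Mat (Ω : Opens E3) : Type := PiLp 2 fun _ : Fin 3 × Fin 3 => L2 Ω

/-- The weak gradient. -/
def weakGrad (u : L2 Ω) : L2Vec Ω := WithLp.toLp 2 fun i => weakDeriv i u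

/-- The weak Hessian. -/
def weakHess (u : L2 Ω) : L2Mat Ω :=
  WithLp.toLp 2 fun k => weakDeriv k.1 (weakDeriv k.2 u)

/-- A test function together with its gradient. -/
def testGraphMap (Ω : Opens E3) : 𝓓(Ω, ℝ) →ₗ[ℝ] L2 Ω × L2Vec Ω where
  toFun φ := (testL2 φ, weakGrad (testL2 φ))
  map_add' φ ψ := by
    refine Prod.ext rfl ?_
    ext1 i
    exact ((hasWeakDeriv_testL2 i φ).add (hasWeakDeriv_testL2 i ψ)).weakDeriv_eq.trans
      (congrArg₂ _ (hasWeakDeriv_testL2 i φ).weakDeriv_eq.symm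
        (hasWeakDeriv_testL2 i ψ).weakDeriv_eq.symm)
  map_smul' c φ := by
    refine Prod.ext rfl ?_
    ext1 i
    exact ((hasWeakDeriv_testL2 i φ).smul c).weakDeriv_eq.trans
      (congrArg _ (hasWeakDeriv_testL2 i φ).weakDeriv_eq.symm)

/-- The graph of the gradient on `H¹₀(Ω)`. -/
def gradGraph (Ω : Opens E3) : Submodule ℝ (L2 Ω × L2Vec Ω) :=
  (LinearMap.range (testGraphMap Ω)).topologicalClosure

/-- Density principle: a closed condition on `H¹₀` need only be checked on test functions. -/
theorem gradGraph_induction {P : L2 Ω × L2Vec Ω → Prop} (hP : IsClosed {p | P p})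
    (h : ∀ φ : 𝓓(Ω, ℝ), P (testL2 φ, WithLp.toLp 2 fun i => testL2 (testPartial i φ)))
    {p : L2 Ω × L2Vec Ω} (hp : p ∈ gradGraph Ω) : P p := by
  refine closure_minimal ?_ hP hp
  rintro _ ⟨φ, rfl⟩
  have : testGraphMap Ω φ = (testL2 φ, WithLp.toLp 2 fun i => testL2 (testPartial i φ)) := by
    refine Prod.ext rfl ?_
    ext1 i
    exact (hasWeakDeriv_testL2 i φ).weakDeriv_eq
  rw [this]
  exact h φ

theorem hasWeakDeriv_of_mem_gradGraph {p : L2 Ω × L2Vec Ω} (hp : p ∈ gradGraph Ω) (i : Fin 3) :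
    HasWeakDeriv i p.1 (p.2 i) := by
  refine gradGraph_induction (P := fun p => HasWeakDeriv i p.1 (p.2 i)) ?_
    (fun φ => hasWeakDeriv_testL2 i φ) hp
  exact (isClosed_hasWeakDeriv i).preimage
    (f := fun p : L2 Ω × L2Vec Ω => (p.1, p.2 i)) (by fun_prop)

theorem snd_eq_weakGrad_of_mem_gradGraph {p : L2 Ω × L2Vec Ω} (hp : p ∈ gradGraph Ω) :
    p.2 = weakGrad p.1 := by
  ext1 i
  exact (hasWeakDeriv_of_mem_gradGraph hp i).weakDeriv_eq.symm

theorem h1Norm_eq (u : L2 Ω) : h1Norm u = Real.sqrt (‖u‖ ^ 2 + ‖weakGrad u‖ ^ 2) := by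
  rw [h1Norm, PiLp.norm_sq_eq_of_L2]
  rfl

theorem weakGrad_sub {u v : L2 Ω} (hu : u ∈ H1 Ω) (hv : v ∈ H1 Ω) :
    weakGrad (u - v) = weakGrad u - weakGrad v := by
  ext1 i
  exact ((weakDeriv_spec hu i).sub (weakDeriv_spec hv i)).weakDeriv_eq

theorem testL2_mem_H1 (φ : 𝓓(Ω, ℝ)) : testL2 φ ∈ H1 Ω := fun i => ⟨_, hasWeakDeriv_testL2 i φ⟩

theorem mem_H1_of_mem_gradGraph {p : L2 Ω × L2Vec Ω} (hp : p ∈ gradGraph Ω) : p.1 ∈ H1 Ω :=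
  fun i => ⟨_, hasWeakDeriv_of_mem_gradGraph hp i⟩

/-- The sup norm of `(u, ∇u)` and `h1Norm u` agree up to a factor `√2`, so both closures coincide.
-/
theorem mem_H10_iff {u : L2 Ω} : u ∈ H10 Ω ↔ (u, weakGrad u) ∈ gradGraph Ω := by
  have hcl : ∀ p : L2 Ω × L2Vec Ω, p ∈ gradGraph Ω ↔
      ∀ ε > 0, ∃ φ : 𝓓(Ω, ℝ), dist p (testGraphMap Ω φ) < ε := by
    intro p
    refine Metric.mem_closure_iff.trans ?_
    simp
  have hdist : ∀ (_ : u ∈ H1 Ω) (φ : 𝓓(Ω, ℝ)), dist (u, weakGrad u) (testGraphMap Ω φ) =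
      max ‖u - testL2 φ‖ ‖weakGrad (u - testL2 φ)‖ := by
    intro hu φ
    rw [weakGrad_sub hu (testL2_mem_H1 φ), ← dist_eq_norm, ← dist_eq_norm]
    rfl
  constructor
  · rintro ⟨hu, h⟩
    rw [hcl]
    intro ε hε
    obtain ⟨φ, hφ⟩ := h ε hε
    refine ⟨φ, (hdist hu φ).trans_lt (lt_of_le_of_lt ?_ hφ)⟩
    rw [h1Norm_eq]
    exact max_le (Real.le_sqrt_of_sq_le (by nlinarith [sq_nonneg ‖weakGrad (u - testL2 φ)‖]))
      (Real.le_sqrt_of_sq_le (by nlinarith [sq_nonneg ‖u - testL2 φ‖]))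
  · intro h
    have hu : u ∈ H1 Ω := mem_H1_of_mem_gradGraph h
    refine ⟨hu, fun ε hε => ?_⟩
    -- Two components below `ε / 2` give `h1Norm` below `ε / √2 < ε`.
    obtain ⟨φ, hφ⟩ := (hcl _).1 h (ε / 2) (half_pos hε)
    rw [hdist hu, max_lt_iff] at hφ
    refine ⟨φ, ?_⟩
    rw [h1Norm_eq, Real.sqrt_lt' hε]
    nlinarith [hφ.1, hφ.2, norm_nonneg (u - testL2 φ), norm_nonneg (weakGrad (u - testL2 φ))]

theorem mem_gradGraph_iff {p : L2 Ω × L2Vec Ω} :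
    p ∈ gradGraph Ω ↔ p.1 ∈ H10 Ω ∧ p.2 = weakGrad p.1 := by
  constructor
  · intro hp
    have h := snd_eq_weakGrad_of_mem_gradGraph hp
    refine ⟨mem_H10_iff.2 ?_, h⟩
    rwa [← h]
  · rintro ⟨h1, h2⟩
    obtain ⟨u, g⟩ := p
    obtain rfl : g = weakGrad u := h2
    exact mem_H10_iff.1 h1

theorem isClosed_gradGraph : IsClosed (gradGraph Ω : Set (L2 Ω × L2Vec Ω)) :=
  Submodule.isClosed_topologicalClosure _

/-- The Poincaré inequality on `H¹₀(Ω)`. -/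
theorem norm_le_norm_weakDeriv {R : ℝ} (hR0 : 0 ≤ R) (hR : ∀ x ∈ Ω, ‖x‖ ≤ R) {u : L2 Ω}
    (hu : u ∈ H10 Ω) (i : Fin 3) : ‖u‖ ≤ 2 * R * ‖weakDeriv i u‖ := by
  have hcl : IsClosed {p : L2 Ω × L2Vec Ω | ‖p.1‖ ≤ 2 * R * ‖p.2 i‖} := by
    have h2 : Continuous fun p : L2 Ω × L2Vec Ω => p.2 i :=
      (PiLp.continuous_apply 2 _ i).comp continuous_snd
    exact isClosed_le continuous_fst.norm (continuous_const.mul h2.norm)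
  have h := gradGraph_induction (P := fun p => ‖p.1‖ ≤ 2 * R * ‖p.2 i‖) hcl
    (fun φ => norm_testL2_le hR0 hR i φ) (mem_H10_iff.1 hu)
  exact h

theorem norm_weakDeriv_le_norm_weakGrad (u : L2 Ω) (i : Fin 3) :
    ‖weakDeriv i u‖ ≤ ‖weakGrad u‖ :=
  PiLp.norm_apply_le (weakGrad u) i

/-- Integration by parts against a function in `H¹₀(Ω)`. -/
theorem HasWeakDeriv.inner_weakDeriv {i : Fin 3} {w g u : L2 Ω} (hw : HasWeakDeriv i w g)
    (hu : u ∈ H10 Ω) : inner ℝ w (weakDeriv i u) = - inner ℝ g u :=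
  gradGraph_induction (P := fun p => inner ℝ w (p.2 i) = - inner ℝ g p.1)
    (isClosed_eq (by fun_prop) (by fun_prop)) (fun φ => hasWeakDeriv_iff_inner.1 hw φ)
    (mem_H10_iff.1 hu)

/-! ### The Hessian on `H²(Ω) ∩ H¹₀(Ω)` as a closed operator -/

theorem norm_weakDeriv_weakDeriv_le (u : L2 Ω) (i j : Fin 3) :
    ‖weakDeriv i (weakDeriv j u)‖ ≤ ‖weakHess u‖ :=
  PiLp.norm_apply_le (weakHess u) (i, j)

/-- Integration by parts gives `‖∂ᵢu‖² = -⟪∂ᵢ∂ᵢu, u⟫ ≤ ‖∇²u‖ * (2 * R * ‖∂ᵢu‖)`, the last factor by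
Poincaré. Only `u`, not `∂ᵢu`, has to lie in `H¹₀`. -/
theorem norm_le_norm_weakHess {R : ℝ} (hR0 : 0 ≤ R) (hR : ∀ x ∈ Ω, ‖x‖ ≤ R) {u : L2 Ω}
    (hu : u ∈ Psi Ω) : ‖u‖ ≤ (2 * R) ^ 2 * ‖weakHess u‖ ∧
      ∀ i, ‖weakDeriv i u‖ ≤ 2 * R * ‖weakHess u‖ := by
  have main : ∀ i, ‖weakDeriv i u‖ ≤ 2 * R * ‖weakHess u‖ := by
    intro i
    have h1 := (weakDeriv_spec (hu.1.2 i) i).inner_weakDeriv hu.2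
    rw [real_inner_self_eq_norm_sq] at h1
    have h2 := (abs_le.1 (abs_real_inner_le_norm (weakDeriv i (weakDeriv i u)) u)).1
    have h3 := norm_le_norm_weakDeriv hR0 hR hu.2 i
    have h4 := norm_weakDeriv_weakDeriv_le u i i
    rcases (norm_nonneg (weakDeriv i u)).eq_or_lt with h0 | h0
    · rw [← h0]
      positivity
    · refine le_of_mul_le_mul_right ?_ h0
      have h5 := mul_le_mul h4 h3 (norm_nonneg _) (norm_nonneg _)
      nlinarith
  refine ⟨(norm_le_norm_weakDeriv hR0 hR hu.2 0).trans ?_, main⟩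
  rw [pow_two, mul_assoc (2 * R)]
  exact mul_le_mul_of_nonneg_left (main 0) (by positivity)

theorem H1.add {u v : L2 Ω} (hu : u ∈ H1 Ω) (hv : v ∈ H1 Ω) : u + v ∈ H1 Ω :=
  fun i => ⟨_, (weakDeriv_spec hu i).add (weakDeriv_spec hv i)⟩

theorem H1.smul (c : ℝ) {u : L2 Ω} (hu : u ∈ H1 Ω) : c • u ∈ H1 Ω :=
  fun i => ⟨_, (weakDeriv_spec hu i).smul c⟩

/-- Membership in `H1` keeps out the default value `0` of `weakDeriv`, which would spoil additivity.
-/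
theorem weakDeriv_add {u v : L2 Ω} (hu : u ∈ H1 Ω) (hv : v ∈ H1 Ω) (i : Fin 3) :
    weakDeriv i (u + v) = weakDeriv i u + weakDeriv i v :=
  ((weakDeriv_spec hu i).add (weakDeriv_spec hv i)).weakDeriv_eq

theorem weakDeriv_smul (c : ℝ) {u : L2 Ω} (hu : u ∈ H1 Ω) (i : Fin 3) :
    weakDeriv i (c • u) = c • weakDeriv i u :=
  ((weakDeriv_spec hu i).smul c).weakDeriv_eq

theorem weakDeriv_zero (i : Fin 3) : weakDeriv i (0 : L2 Ω) = 0 :=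
  (hasWeakDeriv_zero i).weakDeriv_eq

theorem zero_mem_H1 : (0 : L2 Ω) ∈ H1 Ω := fun i => ⟨0, hasWeakDeriv_zero i⟩

theorem H10.add {u v : L2 Ω} (hu : u ∈ H10 Ω) (hv : v ∈ H10 Ω) : u + v ∈ H10 Ω :=
  (mem_gradGraph_iff.1 ((gradGraph Ω).add_mem (mem_H10_iff.1 hu) (mem_H10_iff.1 hv))).1

theorem H10.smul (c : ℝ) {u : L2 Ω} (hu : u ∈ H10 Ω) : c • u ∈ H10 Ω :=
  (mem_gradGraph_iff.1 ((gradGraph Ω).smul_mem c (mem_H10_iff.1 hu))).1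

theorem zero_mem_H10 : (0 : L2 Ω) ∈ H10 Ω :=
  (mem_gradGraph_iff.1 (gradGraph Ω).zero_mem).1

theorem zero_mem_Psi : (0 : L2 Ω) ∈ Psi Ω :=
  ⟨⟨zero_mem_H1, fun i => by rw [weakDeriv_zero]; exact zero_mem_H1⟩, zero_mem_H10⟩

/-- The graph of the Hessian on `H²(Ω) ∩ H¹₀(Ω)`. -/
def hessGraph (Ω : Opens E3) : Submodule ℝ (L2 Ω × L2Mat Ω) where
  carrier := {p | p.1 ∈ Psi Ω ∧ p.2 = weakHess p.1}
  zero_mem' := by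
    refine ⟨zero_mem_Psi, ?_⟩
    ext1 k
    exact ((congrArg (weakDeriv k.1) (weakDeriv_zero k.2)).trans (weakDeriv_zero k.1)).symm
  add_mem' := by
    rintro ⟨u, A⟩ ⟨v, B⟩ ⟨hu, hA⟩ ⟨hv, hB⟩
    obtain rfl : A = weakHess u := hA
    obtain rfl : B = weakHess v := hB
    refine ⟨⟨⟨H1.add hu.1.1 hv.1.1, fun i => ?_⟩, H10.add hu.2 hv.2⟩, ?_⟩
    · change weakDeriv i (u + v) ∈ H1 Ω
      rw [weakDeriv_add hu.1.1 hv.1.1]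
      exact H1.add (hu.1.2 i) (hv.1.2 i)
    · ext1 k
      change _ = weakDeriv k.1 (weakDeriv k.2 (u + v))
      rw [weakDeriv_add hu.1.1 hv.1.1, weakDeriv_add (hu.1.2 _) (hv.1.2 _)]
      rfl
  smul_mem' := by
    rintro c ⟨u, A⟩ ⟨hu, hA⟩
    obtain rfl : A = weakHess u := hA
    refine ⟨⟨⟨H1.smul c hu.1.1, fun i => ?_⟩, H10.smul c hu.2⟩, ?_⟩
    · change weakDeriv i (c • u) ∈ H1 Ω
      rw [weakDeriv_smul c hu.1.1]
      exact H1.smul c (hu.1.2 i)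
    · ext1 k
      change _ = weakDeriv k.1 (weakDeriv k.2 (c • u))
      rw [weakDeriv_smul c hu.1.1, weakDeriv_smul c (hu.1.2 _)]
      rfl

theorem mem_hessGraph_iff {p : L2 Ω × L2Mat Ω} :
    p ∈ hessGraph Ω ↔ p.1 ∈ Psi Ω ∧ p.2 = weakHess p.1 := Iff.rfl

/-- Convergence of `uₙ` and `∇²uₙ` says nothing directly about `∇uₙ`; the bound of the gradient by
the Hessian makes it Cauchy. Closedness of weak derivatives then identifies all limits. -/
theorem isClosed_hessGraph {R : ℝ} (hR0 : 0 ≤ R) (hR : ∀ x ∈ Ω, ‖x‖ ≤ R) :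
    IsClosed (hessGraph Ω : Set (L2 Ω × L2Mat Ω)) := by
  refine IsSeqClosed.isClosed fun x p hx hp => ?_
  have hx1 : Filter.Tendsto (fun n => (x n).1) Filter.atTop (nhds p.1) :=
    (continuous_fst.tendsto p).comp hp
  have hx2 : Filter.Tendsto (fun n => (x n).2) Filter.atTop (nhds p.2) :=
    (continuous_snd.tendsto p).comp hp
  have hbd : ∀ m n i, ‖weakDeriv i (x m).1 - weakDeriv i (x n).1‖ ≤
      2 * R * ‖(x m).2 - (x n).2‖ := by
    intro m n i
    have hmn := (hessGraph Ω).sub_mem (hx m) (hx n)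
    have h := (norm_le_norm_weakHess hR0 hR hmn.1).2 i
    rw [← hmn.2] at h
    have hs : weakDeriv i ((x m).1 - (x n).1) = _ :=
      ((weakDeriv_spec (hx m).1.1.1 i).sub (weakDeriv_spec (hx n).1.1.1 i)).weakDeriv_eq
    rw [← hs]
    exact h
  have hlim : ∀ i, ∃ g, Filter.Tendsto (fun n => weakDeriv i (x n).1) Filter.atTop (nhds g) := by
    intro i
    refine cauchySeq_tendsto_of_complete (Metric.cauchySeq_iff.2 fun ε hε => ?_)
    -- The `+ 1` keeps the denominator positive when `R = 0`.
    obtain ⟨N, hN⟩ := Metric.cauchySeq_iff.1 hx2.cauchySeq (ε / (2 * R + 1)) (by positivity)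
    refine ⟨N, fun m hm n hn => ?_⟩
    have h := hN m hm n hn
    rw [lt_div_iff₀ (by positivity), dist_eq_norm] at h
    rw [dist_eq_norm]
    refine (hbd m n i).trans_lt (lt_of_le_of_lt ?_ h)
    nlinarith [norm_nonneg ((x m).2 - (x n).2)]
  choose g hg using hlim
  have hgrad : (p.1, WithLp.toLp 2 g) ∈ gradGraph Ω := by
    refine isClosed_gradGraph.mem_of_tendsto
      (f := fun n => ((x n).1, weakGrad (x n).1)) (hx1.prodMk_nhds ?_)
      (Filter.Eventually.of_forall fun n => mem_H10_iff.1 (hx n).1.2)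
    exact ((PiLp.continuous_toLp 2 _).tendsto g).comp (tendsto_pi_nhds.2 hg)
  have hg1 : ∀ i, weakDeriv i p.1 = g i := fun i =>
    (hasWeakDeriv_of_mem_gradGraph hgrad i).weakDeriv_eq
  have hg2 : ∀ i j, HasWeakDeriv i (weakDeriv j p.1) (p.2 (i, j)) := by
    intro i j
    rw [hg1]
    refine (isClosed_hasWeakDeriv i).mem_of_tendsto
      (f := fun n => (weakDeriv j (x n).1, (x n).2 (i, j))) ((hg j).prodMk_nhds ?_)
      (Filter.Eventually.of_forall fun n => ?_)
    · exact ((PiLp.continuous_apply 2 _ (i, j)).tendsto p.2).comp hx2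
    · rw [(hx n).2]
      exact weakDeriv_spec ((hx n).1.1.2 j) i
  refine ⟨⟨⟨mem_H1_of_mem_gradGraph hgrad, fun j i => ⟨_, hg2 i j⟩⟩,
    (mem_gradGraph_iff.1 hgrad).1⟩, ?_⟩
  ext1 k
  exact (hg2 k.1 k.2).weakDeriv_eq.symm

/-! ### The variational problems and their decoupling -/

theorem aZero_eq_inner (σ ψ : L2 Ω) : aZero σ ψ = inner ℝ σ ψ := (inner_eq_integral σ ψ).symm

theorem load_eq_inner (f v : L2 Ω) : load f v = inner ℝ (-f) v := by
  rw [inner_neg_left, inner_eq_integral]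
  rfl

theorem aNabla_eq_inner (σ v : L2 Ω) : aNabla σ v = inner ℝ (weakGrad σ) (weakGrad v) := by
  rw [aNabla, integral_finsetSum _ fun i _ => integrable_mul _ _, PiLp.inner_apply]
  exact Finset.sum_congr rfl fun i _ => (inner_eq_integral _ _).symm

theorem aDelta_eq_inner (u ψ : L2 Ω) : aDelta u ψ = inner ℝ (weakHess u) (weakHess ψ) := by
  rw [aDelta, integral_finsetSum _ fun i _ => integrable_finsetSum _ fun j _ => integrable_mul _ _,
    PiLp.inner_apply, Fintype.sum_prod_type]
  refine Finset.sum_congr rfl fun i _ => ?_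
  rw [integral_finsetSum _ fun j _ => integrable_mul _ _]
  exact Finset.sum_congr rfl fun j _ => (inner_eq_integral _ _).symm

theorem exists_radius (hΩ : Bornology.IsBounded (Ω : Set E3)) :
    ∃ R : ℝ, 0 ≤ R ∧ ∀ x ∈ Ω, ‖x‖ ≤ R := by
  obtain ⟨R, hR, h⟩ := hΩ.exists_pos_norm_le
  exact ⟨R, hR.le, h⟩

theorem existsUnique_isPoissonSolution (hΩ : Bornology.IsBounded (Ω : Set E3)) (f : L2 Ω) :
    ∃! σ : L2 Ω, IsPoissonSolution f σ := by
  obtain ⟨R, hR0, hR⟩ := exists_radius hΩ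
  obtain ⟨p, ⟨hp, hpq⟩, hu⟩ := existsUnique_mem_graph_inner_eq (gradGraph Ω) isClosed_gradGraph
    (2 * R) (fun p hp => by
      obtain ⟨h1, h2⟩ := mem_gradGraph_iff.1 hp
      rw [h2]
      exact (norm_le_norm_weakDeriv hR0 hR h1 0).trans
        (mul_le_mul_of_nonneg_left (norm_weakDeriv_le_norm_weakGrad _ _) (by positivity))) (-f)
  obtain ⟨hp1, hp2⟩ := mem_gradGraph_iff.1 hp
  refine ⟨p.1, ⟨hp1, fun v hv => ?_⟩, fun σ hσ => ?_⟩
  · rw [aNabla_eq_inner, load_eq_inner, ← hp2]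
    exact hpq _ (mem_H10_iff.1 hv)
  · refine congrArg Prod.fst (hu (σ, weakGrad σ) ⟨mem_H10_iff.1 hσ.1, fun q hq => ?_⟩)
    obtain ⟨hq1, hq2⟩ := mem_gradGraph_iff.1 hq
    have h := hσ.2 q.1 hq1
    rwa [aNabla_eq_inner, load_eq_inner, ← hq2] at h

theorem existsUnique_isFourthOrderSolution (hΩ : Bornology.IsBounded (Ω : Set E3)) (σ : L2 Ω) :
    ∃! u : L2 Ω, IsFourthOrderSolution σ u := by
  obtain ⟨R, hR0, hR⟩ := exists_radius hΩ
  obtain ⟨p, ⟨hp, hpq⟩, hu⟩ := existsUnique_mem_graph_inner_eq (hessGraph Ω)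
    (isClosed_hessGraph hR0 hR) ((2 * R) ^ 2) (fun p hp => by
      rw [hp.2]
      exact (norm_le_norm_weakHess hR0 hR hp.1).1) (-σ)
  refine ⟨p.1, ⟨hp.1, fun ψ hψ => ?_⟩, fun u h => ?_⟩
  · rw [aDelta_eq_inner, aZero_eq_inner, ← inner_neg_left, ← hp.2]
    exact hpq (ψ, weakHess ψ) ⟨hψ, rfl⟩
  · refine congrArg Prod.fst (hu (u, weakHess u) ⟨⟨h.1, rfl⟩, fun q hq => ?_⟩)
    have h' := h.2 q.1 hq.1
    rwa [aDelta_eq_inner, aZero_eq_inner, ← inner_neg_left, ← hq.2] at h'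

/-- Zero is admissible in both test spaces and kills the forms it enters, which isolates each
equation; conversely the two equations add up. -/
theorem isMixedSolution_iff (f σ u : L2 Ω) :
    IsMixedSolution f σ u ↔ IsPoissonSolution f σ ∧ IsFourthOrderSolution σ u := by
  have hD : aDelta u 0 = 0 := by
    have h : (0 : L2Mat Ω) = weakHess 0 := (mem_hessGraph_iff.1 (hessGraph Ω).zero_mem).2
    rw [aDelta_eq_inner, ← h]
    exact inner_zero_right _
  have hN : aNabla σ 0 = 0 := by
    have h : (0 : L2Vec Ω) = weakGrad 0 := (mem_gradGraph_iff.1 (gradGraph Ω).zero_mem).2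
    rw [aNabla_eq_inner, ← h]
    exact inner_zero_right _
  have hZ : aZero σ 0 = 0 := by rw [aZero_eq_inner, inner_zero_right]
  have hL : load f 0 = 0 := by rw [load_eq_inner, inner_zero_right]
  constructor
  · rintro ⟨hσ, hu, h⟩
    refine ⟨⟨hσ, fun v hv => ?_⟩, hu, fun ψ hψ => ?_⟩
    · have := h v hv 0 zero_mem_Psi
      linarith
    · have := h 0 zero_mem_H10 ψ hψ
      linarith
  · rintro ⟨⟨hσ, h1⟩, hu, h2⟩
    refine ⟨hσ, hu, fun v hv ψ hψ => ?_⟩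
    rw [h1 v hv, h2 ψ hψ]
    ring

theorem existsUnique_isMixedSolution (hΩ : Bornology.IsBounded (Ω : Set E3)) (f : L2 Ω) :
    ∃! p : L2 Ω × L2 Ω, IsMixedSolution f p.1 p.2 := by
  obtain ⟨σ, hσ, hσu⟩ := existsUnique_isPoissonSolution hΩ f
  obtain ⟨u, hu, huu⟩ := existsUnique_isFourthOrderSolution hΩ σ
  refine ⟨(σ, u), (isMixedSolution_iff f σ u).2 ⟨hσ, hu⟩, ?_⟩
  rintro ⟨σ', u'⟩ h
  obtain ⟨h1, h2⟩ := (isMixedSolution_iff f σ' u').1 h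
  obtain rfl := hσu σ' h1
  obtain rfl := huu u' h2
  rfl

end SixthOrder

end

theorem mainTheorem7 (Ω : TopologicalSpace.Opens SixthOrder.E3)
    (hΩ : Bornology.IsBounded (Ω : Set SixthOrder.E3)) (f : SixthOrder.L2 Ω) :
    (∃! p : SixthOrder.L2 Ω × SixthOrder.L2 Ω, SixthOrder.IsMixedSolution f p.1 p.2) ∧
    (∃! σ : SixthOrder.L2 Ω, SixthOrder.IsPoissonSolution f σ) ∧
    (∀ σ ∈ SixthOrder.H10 Ω, ∃! u : SixthOrder.L2 Ω, SixthOrder.IsFourthOrderSolution σ u) ∧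
    (∀ σ u : SixthOrder.L2 Ω, SixthOrder.IsMixedSolution f σ u ↔
      SixthOrder.IsPoissonSolution f σ ∧ SixthOrder.IsFourthOrderSolution σ u) := by
  exact ⟨SixthOrder.existsUnique_isMixedSolution hΩ f,
    SixthOrder.existsUnique_isPoissonSolution hΩ f,
    fun σ _ => SixthOrder.existsUnique_isFourthOrderSolution hΩ σ,
    SixthOrder.isMixedSolution_iff f⟩
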